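/- For positive integers $n, q$ and an integer $b$ let $\theta(n;q,b)=\sum_{p\le n,\ p\equiv b\ (\mathrm{mod}\ q)}\log p$, the sum being over primes $p$, and let $$P(n)=\prod_{p\nmid n}\Big(1-\frac{1}{p(p-1)}\Big),$$ the product being over the primes $p$ not dividing $n$. Let $\mu$ be the Möbius function and $\varphi$ Euler's totient function. Let $0<A<1/2$ and $c>1$ be real numbers. Suppose that for every integer $a$ with $1<a\le c$ there are a real number $x_a$ and real numbers $E(a,n)$ such that $$\Big|\theta(n;a^2,n)-\frac{n}{\varphi(a^2)}\Big|\le E(a,n)\qquad\text{for all integers } n\ge 1 \text{ with } n\ge x_a \text{ and } (a,n)=1,$$ and let $x_0$ be a real number with $x_0\ge x_a$ for all integers $1<a\le c$ (for instance the maximum of the $x_a$). Then for every integer $n\ge 1$ with $n\ge x_0$ and $$1>P(n)+n^{-1}\sum_{\substack{1<a\le c\\(a,n)=1}}\mu^2(a)E(a,n)+\Big(\frac{1+2A}{1-2A}\Big)\frac{4}{c-1}+\frac{3\log n}{n^{A}}$$ we have $$\sum_{1<a\le\sqrt n}\mu(a)\,\theta(n;a^2,n)<0,$$ and $n$ is the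 sum of a prime and a positive integer that is not square-free. -/

import Mathlib

/-- The Chebyshev function in arithmetic progressions, `θ(x; q, b)`: the sum of `log p`
over the primes `p ≤ x` with `p ≡ b (mod q)`. -/
noncomputable def thetaAP (x q b : ℕ) : ℝ :=
  ∑ p ∈ Finset.Icc 1 x with p.Prime ∧ p ≡ b [MOD q], Real.log p

/-- The infinite product `P(n) = ∏_{p ∤ n} (1 - 1 / (p (p - 1)))` over the primes `p` not
dividing `n`. -/
noncomputable def primeProd (n : ℕ) : ℝ :=
  ∏' p : {p : ℕ // p.Prime ∧ ¬ p ∣ n}, (1 - 1 / ((p : ℝ) * ((p : ℝ) - 1)))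

/-- The product defining `primeProd n` converges, so `∏'` is not a default value. -/
theorem multipliable_primeProd (n : ℕ) :
    Multipliable fun p : {p : ℕ // p.Prime ∧ ¬ p ∣ n} =>
      (1 - 1 / ((p : ℝ) * ((p : ℝ) - 1))) := by
  have h1 : Summable fun m : ℕ => 2 * (1 / (m : ℝ) ^ 2) :=
    (Real.summable_one_div_nat_pow.mpr one_lt_two).mul_left 2
  have h2 : Summable fun p : {p : ℕ // p.Prime ∧ ¬ p ∣ n} => 2 * (1 / ((p : ℕ) : ℝ) ^ 2) :=
    h1.comp_injective Subtype.val_injective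
  have h3 : Summable fun p : {p : ℕ // p.Prime ∧ ¬ p ∣ n} =>
      -(1 / ((p : ℝ) * ((p : ℝ) - 1))) := by
    refine (Summable.of_nonneg_of_le (fun p => ?_) (fun p => ?_) h2).neg
    · have hp : (2 : ℝ) ≤ ((p : ℕ) : ℝ) := by exact_mod_cast p.2.1.two_le
      have : (0 : ℝ) ≤ ((p : ℕ) : ℝ) - 1 := by linarith
      positivity
    · have hp : (2 : ℝ) ≤ ((p : ℕ) : ℝ) := by exact_mod_cast p.2.1.two_le
      rw [mul_one_div, div_le_div_iff₀ (by nlinarith) (by positivity)]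
      nlinarith
  simpa [sub_eq_add_neg] using Real.multipliable_one_add_of_summable h3

open Finset

/-! ### The factors `1 - 1 / (p (p - 1))` -/

/-! Let `W` be the sum of `log p` over primes `p < n` with `n - p` not square-free. Möbius inversion
over square divisors makes the sum in the theorem equal to `-W`, except that a prime `n` is itself
counted in every `θ(n; a², n)`, which adds at most `(√n - 1) log n`. So `W` must be positive and,
for prime `n`, exceed that amount.

A single prime `p ∤ n` with `p ≤ c` already bounds `W`: if `p² ∣ n - q` then `q` counts in `W`, so
`n / (p (p - 1)) - E(p, n) ≤ W`, up to `log n` when `n` is prime. For composite `n`, `W ≤ 0` would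
force `n / (p (p - 1)) ≤ E(p, n)` for all these `p`; summing and using `P(n) ≥ 1 - ∑ 1 / (p (p -
1))` contradicts the hypothesis. For prime `n`, the primes 2, 3, 5 and `P(n) ≥ 3/10` suffice. -/

theorem one_sub_sum_le_prod_one_sub_of_mem_unit {ι : Type*} (s : Finset ι) (f : ι → ℝ)
    (h₀ : ∀ i ∈ s, 0 ≤ f i) (h₁ : ∀ i ∈ s, f i ≤ 1) :
    1 - ∑ i ∈ s, f i ≤ ∏ i ∈ s, (1 - f i) := by
  classical
  induction s using Finset.induction_on with
  | empty => simp
  | insert a s ha ih =>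
    rw [sum_insert ha, prod_insert ha]
    have ih' := ih (fun i hi => h₀ i (mem_insert_of_mem hi))
      (fun i hi => h₁ i (mem_insert_of_mem hi))
    have hs : 0 ≤ ∑ i ∈ s, f i := sum_nonneg fun i hi => h₀ i (mem_insert_of_mem hi)
    have ha₀ := h₀ a (mem_insert_self a s)
    have ha₁ := h₁ a (mem_insert_self a s)
    nlinarith [mul_le_mul_of_nonneg_left ih' (sub_nonneg.2 ha₁), mul_nonneg ha₀ hs]

/-- The reciprocal of `m (m - 1)`; for a prime `m` it is the reciprocal of `φ (m ^ 2)`. -/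
noncomputable def invPronic (m : ℕ) : ℝ := 1 / ((m : ℝ) * ((m : ℝ) - 1))

theorem invPronic_nonneg (m : ℕ) : 0 ≤ invPronic m := by
  rcases Nat.eq_zero_or_pos m with rfl | hm
  · simp [invPronic]
  · have : (1 : ℝ) ≤ m := by exact_mod_cast hm
    have h : (0 : ℝ) ≤ (m : ℝ) - 1 := by linarith
    unfold invPronic
    positivity

theorem invPronic_le_half {m : ℕ} (hm : 2 ≤ m) : invPronic m ≤ 1 / 2 := by
  have : (2 : ℝ) ≤ m := by exact_mod_cast hm
  exact one_div_le_one_div_of_le two_pos (by nlinarith)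

theorem inv_totient_sq_eq_invPronic {p : ℕ} (hp : p.Prime) :
    1 / ((p ^ 2).totient : ℝ) = invPronic p := by
  rw [Nat.totient_prime_pow_succ hp 1, pow_one, invPronic, Nat.cast_mul,
    Nat.cast_sub hp.one_le, Nat.cast_one]

theorem sum_Ioc_invPronic {k N : ℕ} (hk : 1 ≤ k) (hN : k ≤ N) :
    ∑ m ∈ Ioc k N, invPronic m = 1 / k - 1 / N := by
  induction N, hN using Nat.le_induction with
  | base => simp
  | succ N hN ih =>
    have h0 : (N : ℝ) ≠ 0 := by
      have : 0 < N := by omega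
      positivity
    have h1 : (N : ℝ) + 1 ≠ 0 := by positivity
    rw [sum_Ioc_succ_top (by omega), ih, invPronic]
    push_cast
    rw [add_sub_cancel_right, mul_comm, ← sub_eq_zero]
    field_simp
    ring

theorem sum_invPronic_le {k : ℕ} (hk : 1 ≤ k) (s : Finset ℕ) (hs : ∀ m ∈ s, k < m) :
    ∑ m ∈ s, invPronic m ≤ 1 / k := by
  have hsub : s ⊆ Ioc k (max k (s.sup id)) := fun m hm =>
    mem_Ioc.2 ⟨hs m hm, le_max_of_le_right (le_sup (f := id) hm)⟩
  refine (sum_le_sum_of_subset_of_nonneg hsub fun m _ _ => invPronic_nonneg m).trans ?_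
  rw [sum_Ioc_invPronic hk (le_max_left _ _)]
  have : (0 : ℝ) ≤ 1 / ((max k (s.sup id) : ℕ) : ℝ) := by positivity
  linarith

theorem le_primeProd_of_forall_finset {n : ℕ} {B : ℝ}
    (h : ∀ s : Finset ℕ, (∀ p ∈ s, p.Prime ∧ ¬ p ∣ n) → B ≤ ∏ p ∈ s, (1 - invPronic p)) :
    B ≤ primeProd n := by
  refine ge_of_tendsto' (multipliable_primeProd n).hasProd fun t => ?_
  have := h (t.map (Function.Embedding.subtype _)) (by
    intro p hp
    obtain ⟨q, -, rfl⟩ := mem_map.1 hp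
    exact q.2)
  rwa [prod_map] at this

/-- Factors with `p > k` cost at most `1 / k` in total, by telescoping over all integers above `k`.
-/
theorem one_sub_sum_sub_le_primeProd (n : ℕ) {k : ℕ} (hk : 1 ≤ k) :
    1 - ∑ p ∈ Ioc 1 k with p.Prime ∧ ¬ p ∣ n, invPronic p - 1 / k ≤ primeProd n := by
  refine le_primeProd_of_forall_finset fun s hs => ?_
  have h1 := one_sub_sum_le_prod_one_sub_of_mem_unit s invPronic
    (fun p _ => invPronic_nonneg p)
    (fun p hp => (invPronic_le_half (hs p hp).1.two_le).trans (by norm_num))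
  have h2 := sum_invPronic_le hk {p ∈ s | ¬ p ≤ k} fun p hp => by
    simpa using (mem_filter.1 hp).2
  have h3 : ∑ p ∈ s with p ≤ k, invPronic p
      ≤ ∑ p ∈ Ioc 1 k with p.Prime ∧ ¬ p ∣ n, invPronic p := by
    refine sum_le_sum_of_subset_of_nonneg (fun p hp => ?_) fun p _ _ => invPronic_nonneg p
    obtain ⟨hp, hpk⟩ := mem_filter.1 hp
    exact mem_filter.2 ⟨mem_Ioc.2 ⟨(hs p hp).1.one_lt, hpk⟩, hs p hp⟩
  have h4 := sum_filter_add_sum_filter_not s (fun p => p ≤ k) invPronic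
  linarith

/-- Splitting off the factor `1/2` at 2 leaves at least `1 - 1/6 - 1/20 - 1/6`, from 3, 5 and the
tail beyond 6; half of this is `37/120`. -/
theorem three_tenths_le_primeProd (n : ℕ) : 3 / 10 ≤ primeProd n := by
  refine le_primeProd_of_forall_finset fun s hs => ?_
  have hsub : s.erase 2 ⊆ {3, 5} ∪ {p ∈ s | 6 < p} := by
    intro p hp
    obtain ⟨hp2, hps⟩ := mem_erase.1 hp
    by_cases h6 : 6 < p
    · simp [h6, hps]
    · have hpr := (hs p hps).1
      have : p ≤ 6 := by omega
      interval_cases p <;> first | omega | (exfalso; revert hpr; norm_num; done) | simp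
  have h1 : ∑ p ∈ s.erase 2, invPronic p ≤ 1 / 6 + 1 / 20 + 1 / 6 := by
    refine (sum_le_sum_of_subset_of_nonneg hsub fun p _ _ => invPronic_nonneg p).trans ?_
    rw [sum_union (by
      rw [disjoint_left]
      intro p hp hp'
      have := (mem_filter.1 hp').2
      simp only [mem_insert, mem_singleton] at hp
      omega)]
    have h2 := sum_invPronic_le (k := 6) (by norm_num) {p ∈ s | 6 < p} fun p hp =>
      (mem_filter.1 hp).2
    have h3 : ∑ p ∈ ({3, 5} : Finset ℕ), invPronic p = 1 / 6 + 1 / 20 := by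
      rw [sum_pair (by norm_num)]
      norm_num [invPronic]
    push_cast at h2
    linarith
  have h2 := one_sub_sum_le_prod_one_sub_of_mem_unit (s.erase 2) invPronic
    (fun p _ => invPronic_nonneg p)
    (fun p hp => (invPronic_le_half (hs p (mem_of_mem_erase hp)).1.two_le).trans (by norm_num))
  by_cases h : 2 ∈ s
  · rw [← mul_prod_erase s _ h]
    have : invPronic 2 = 1 / 2 := by norm_num [invPronic]
    rw [this]
    linarith
  · rw [erase_eq_of_notMem h] at h1 h2
    linarith

/-! ### Sums of the Möbius function over square divisors -/

theorem sum_divisors_moebius (b : ℕ) :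
    ∑ a ∈ b.divisors, ArithmeticFunction.moebius a = if b = 1 then 1 else 0 := by
  rw [← ArithmeticFunction.coe_mul_zeta_apply, ArithmeticFunction.moebius_mul_coe_zeta,
    ArithmeticFunction.one_apply]

/-- With `m = b² s` and `s` square-free, `a² ∣ m` iff `a ∣ b`, so this is the Möbius sum over
divisors of `b` without the term `a = 1`. -/
theorem sum_moebius_sq_dvd {m N : ℕ} (hm : 0 < m) (hN : Nat.sqrt m ≤ N) :
    ∑ a ∈ Ioc 1 N with a ^ 2 ∣ m, ArithmeticFunction.moebius a
      = if Squarefree m then 0 else -1 := by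
  obtain ⟨s, b, rfl, hs⟩ := Nat.sq_mul_squarefree m
  have hb : b ≠ 0 := by
    rintro rfl
    simp at hm
  have key : ∀ a, a ^ 2 ∣ b ^ 2 * s ↔ a ∣ b := by
    intro a
    refine ⟨fun h => ?_, fun h => (pow_dvd_pow_of_dvd h 2).mul_right s⟩
    rcases eq_or_ne a 0 with rfl | ha
    · rw [zero_pow two_ne_zero, zero_dvd_iff] at h
      omega
    have hg : 0 < a.gcd b := Nat.gcd_pos_of_pos_left _ (by omega)
    obtain ⟨a', b', hco, ha', hb'⟩ := Nat.exists_coprime a b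
    have h0 : (a' * a.gcd b) ^ 2 ∣ (b' * a.gcd b) ^ 2 * s := by rwa [← ha', ← hb']
    rw [mul_pow, mul_pow, mul_right_comm] at h0
    have h' : a' ^ 2 ∣ b' ^ 2 * s := Nat.dvd_of_mul_dvd_mul_right (pow_pos hg 2) h0
    have h'' : a' * a' ∣ s := by
      rw [← sq]
      exact (Nat.Coprime.pow 2 2 hco).dvd_of_dvd_mul_left h'
    have : a' = 1 := Nat.isUnit_iff.1 (hs a' h'')
    rw [ha', this, one_mul]
    exact Nat.gcd_dvd_right a b
  have hbN : b ≤ N := by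
    refine le_trans (Nat.le_sqrt'.2 ?_) hN
    exact Nat.le_of_dvd hm (dvd_mul_right _ _)
  have hset : {a ∈ Ioc 1 N | a ^ 2 ∣ b ^ 2 * s} = b.divisors.erase 1 := by
    ext a
    simp only [mem_filter, mem_Ioc, key, mem_erase, Nat.mem_divisors]
    constructor
    · rintro ⟨⟨h1, -⟩, h⟩
      exact ⟨h1.ne', h, hb⟩
    · rintro ⟨h1, h, -⟩
      have := Nat.le_of_dvd (Nat.pos_of_ne_zero hb) h
      have := Nat.pos_of_dvd_of_pos h (Nat.pos_of_ne_zero hb)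
      exact ⟨⟨by omega, by omega⟩, h⟩
  have hsq : Squarefree (b ^ 2 * s) ↔ b = 1 := by
    refine ⟨fun h => Nat.isUnit_iff.1 (h b ?_), ?_⟩
    · rw [sq]
      exact dvd_mul_right _ _
    · rintro rfl
      simpa using hs
  have h1 := sum_erase_add b.divisors (fun a => ArithmeticFunction.moebius a)
    (Nat.one_mem_divisors.2 hb)
  rw [sum_divisors_moebius, ArithmeticFunction.moebius_apply_one] at h1
  rw [hset]
  simp only [hsq]
  split_ifs at h1 ⊢ <;> omega

/-! ### Primes `p < n` for which `n - p` is not square-free -/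

/-- The sum of `log p` over the primes `p < n` such that `n - p` is not square-free. -/
noncomputable def nonSquarefreeWeight (n : ℕ) : ℝ :=
  ∑ p ∈ Ico 1 n with p.Prime ∧ ¬ Squarefree (n - p), Real.log p

/-- The sum of `log p` over the primes `p < n` with `p ≡ b (mod q)`. -/
noncomputable def thetaAPLt (n q : ℕ) : ℝ :=
  ∑ p ∈ Ico 1 n with p.Prime ∧ q ∣ n - p, Real.log p

theorem thetaAP_self_eq {n : ℕ} (hn : 0 < n) (q : ℕ) :
    thetaAP n q n = thetaAPLt n q + if n.Prime then Real.log n else 0 := by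
  have h : Icc 1 n = insert n (Ico 1 n) := (Ico_insert_right hn).symm
  have h2 : {p ∈ Ico 1 n | p.Prime ∧ p ≡ n [MOD q]} = {p ∈ Ico 1 n | p.Prime ∧ q ∣ n - p} :=
    filter_congr fun p hp => by rw [Nat.modEq_iff_dvd' (mem_Ico.1 hp).2.le]
  rw [thetaAP, thetaAPLt, h, filter_insert, h2]
  by_cases hp : n.Prime
  · rw [if_pos ⟨hp, rfl⟩, if_pos hp, sum_insert (by simp), add_comm]
  · rw [if_neg fun h => hp h.1, if_neg hp, add_zero]

theorem thetaAPLt_sq_le_nonSquarefreeWeight (n : ℕ) {a : ℕ} (ha : 1 < a) :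
    thetaAPLt n (a ^ 2) ≤ nonSquarefreeWeight n := by
  refine sum_le_sum_of_subset_of_nonneg (fun p hp => ?_) fun p hp _ =>
    Real.log_natCast_nonneg p
  obtain ⟨hp, hpr, hd⟩ := mem_filter.1 hp
  refine mem_filter.2 ⟨hp, hpr, fun hsq => ha.ne' ?_⟩
  exact Nat.isUnit_iff.1 (hsq a (by rwa [← sq]))

theorem sum_moebius_mul_thetaAPLt (n : ℕ) :
    ∑ a ∈ Ioc 1 (Nat.sqrt n), (ArithmeticFunction.moebius a : ℝ) * thetaAPLt n (a ^ 2)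
      = -nonSquarefreeWeight n := by
  simp only [thetaAPLt, nonSquarefreeWeight, mul_sum, sum_filter, ← sum_neg_distrib]
  rw [sum_comm]
  refine sum_congr rfl fun p hp => ?_
  obtain ⟨-, hpn⟩ := mem_Ico.1 hp
  by_cases hpr : p.Prime
  · have h := sum_moebius_sq_dvd (m := n - p) (N := Nat.sqrt n) (by omega)
      (Nat.sqrt_le_sqrt (Nat.sub_le n p))
    have h' := congrArg (fun z : ℤ => (z : ℝ) * Real.log p) h
    simp only [Int.cast_sum, sum_mul, sum_filter] at h'
    simp only [hpr, true_and]
    refine Eq.trans (sum_congr rfl fun a _ => ?_) (h'.trans ?_) <;> split_ifs <;> simp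
  · simp [hpr]

theorem sum_moebius_mul_thetaAP_le {n : ℕ} (hn : 0 < n) :
    ∑ a ∈ Ioc 1 (Nat.sqrt n), (ArithmeticFunction.moebius a : ℝ) * thetaAP n (a ^ 2) n
      ≤ -nonSquarefreeWeight n
        + if n.Prime then (Real.sqrt n - 1) * Real.log n else 0 := by
  simp only [thetaAP_self_eq hn, mul_add, sum_add_distrib, sum_moebius_mul_thetaAPLt]
  refine add_le_add le_rfl ?_
  split_ifs
  · rw [← sum_mul]
    refine mul_le_mul_of_nonneg_right ?_ (Real.log_natCast_nonneg n)
    have h1 : ∀ a ∈ Ioc 1 (Nat.sqrt n), (ArithmeticFunction.moebius a : ℝ) ≤ 1 := fun a _ => by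
      exact_mod_cast (abs_le.1 (ArithmeticFunction.abs_moebius_le_one (n := a))).2
    refine (sum_le_sum h1).trans ?_
    have h2 : 1 ≤ Nat.sqrt n := Nat.sqrt_pos.2 hn
    rw [sum_const, Nat.card_Ioc, nsmul_eq_mul, mul_one, Nat.cast_sub h2, Nat.cast_one]
    exact sub_le_sub_right (Real.nat_sqrt_le_real_sqrt) 1
  · simp

theorem exists_prime_add_not_squarefree_of_pos {n : ℕ} (h : 0 < nonSquarefreeWeight n) :
    ∃ p s : ℕ, p.Prime ∧ 0 < s ∧ ¬ Squarefree s ∧ n = p + s := by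
  obtain ⟨p, hp, -⟩ := exists_ne_zero_of_sum_ne_zero h.ne'
  obtain ⟨hp, hpr, hs⟩ := mem_filter.1 hp
  have := (mem_Ico.1 hp).2
  exact ⟨p, n - p, hpr, by omega, hs, by omega⟩

/-! ### Lower bounds from estimates for `θ(n; p ^ 2, n)` -/

theorem nonSquarefreeWeight_ge_of_error {n p : ℕ} (hn : 0 < n) (hp : p.Prime) {e : ℝ}
    (he : |thetaAP n (p ^ 2) n - (n : ℝ) / (Nat.totient (p ^ 2) : ℝ)| ≤ e) :
    (n : ℝ) * invPronic p - e
      ≤ nonSquarefreeWeight n + if n.Prime then Real.log n else 0 := by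
  have h1 := (abs_le.1 he).1
  have h2 := thetaAPLt_sq_le_nonSquarefreeWeight n hp.one_lt
  rw [thetaAP_self_eq hn, div_eq_mul_one_div, inv_totient_sq_eq_invPronic hp] at h1
  linarith

/-- Restricting the weighted sum of the errors to a set of primes. -/
theorem sum_primes_le_sum_moebius_sq {n k : ℕ} {e : ℕ → ℝ}
    (he : ∀ a, 1 < a → a ≤ k → a.Coprime n → 0 ≤ e a) (s : Finset ℕ)
    (hs : ∀ p ∈ s, p.Prime ∧ p ≤ k ∧ ¬ p ∣ n) :
    ∑ p ∈ s, e p ≤ ∑ a ∈ Ioc 1 k with a.Coprime n,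
      (ArithmeticFunction.moebius a : ℝ) ^ 2 * e a := by
  rw [sum_congr rfl (g := fun a => (ArithmeticFunction.moebius a : ℝ) ^ 2 * e a) fun p hp => by
    rw [ArithmeticFunction.moebius_apply_prime (hs p hp).1]
    norm_num]
  refine sum_le_sum_of_subset_of_nonneg (fun p hp => ?_) fun a ha _ => ?_
  · obtain ⟨hpr, hk, hd⟩ := hs p hp
    exact mem_filter.2 ⟨mem_Ioc.2 ⟨hpr.one_lt, hk⟩, (hpr.coprime_iff_not_dvd).2 hd⟩
  · obtain ⟨ha, hco⟩ := mem_filter.1 ha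
    obtain ⟨h1, h2⟩ := mem_Ioc.1 ha
    exact mul_nonneg (sq_nonneg _) (he a h1 h2 hco)

theorem nonSquarefreeWeight_pos_of_not_prime {n k : ℕ} (hn : 0 < n) (hnp : ¬ n.Prime)
    (hk : 1 ≤ k) {e : ℕ → ℝ}
    (he : ∀ a, 1 < a → a ≤ k → a.Coprime n →
      |thetaAP n (a ^ 2) n - (n : ℝ) / (Nat.totient (a ^ 2) : ℝ)| ≤ e a)
    (h : primeProd n + (n : ℝ)⁻¹ * ∑ a ∈ Ioc 1 k with a.Coprime n,
      (ArithmeticFunction.moebius a : ℝ) ^ 2 * e a + 1 / k < 1) :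
    0 < nonSquarefreeWeight n := by
  by_contra hT
  push Not at hT
  have hn' : (0 : ℝ) < n := by exact_mod_cast hn
  have h1 := one_sub_sum_sub_le_primeProd n hk
  have h2 := sum_primes_le_sum_moebius_sq (e := e) (n := n) (k := k)
    (fun a h1 h2 h3 => (abs_nonneg _).trans (he a h1 h2 h3))
    {p ∈ Ioc 1 k | p.Prime ∧ ¬ p ∣ n} fun p hp => by
      obtain ⟨hp, hpr, hd⟩ := mem_filter.1 hp
      exact ⟨hpr, (mem_Ioc.1 hp).2, hd⟩
  have h3 : ∑ p ∈ Ioc 1 k with p.Prime ∧ ¬ p ∣ n, (n : ℝ) * invPronic p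
      ≤ ∑ p ∈ Ioc 1 k with p.Prime ∧ ¬ p ∣ n, e p := by
    refine sum_le_sum fun p hp => ?_
    obtain ⟨hp, hpr, hd⟩ := mem_filter.1 hp
    obtain ⟨hp1, hp2⟩ := mem_Ioc.1 hp
    have := nonSquarefreeWeight_ge_of_error hn hpr
      (he p hp1 hp2 ((hpr.coprime_iff_not_dvd).2 hd))
    rw [if_neg hnp] at this
    linarith
  rw [← mul_sum] at h3
  have h4 := (le_inv_mul_iff₀ hn').2 (h3.trans h2)
  linarith

/-- Using just three moduli incurs the loss `log n` from the prime `n` only three times, which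
matches the coefficient 3 of `δ`. -/
theorem nonSquarefreeWeight_gt_of_prime {n k : ℕ} (hnp : n.Prime) (hn : 5 < n)
    (hk : 5 ≤ k) {e : ℕ → ℝ}
    (he : ∀ a, 1 < a → a ≤ k → a.Coprime n →
      |thetaAP n (a ^ 2) n - (n : ℝ) / (Nat.totient (a ^ 2) : ℝ)| ≤ e a) {δ : ℝ}
    (h : primeProd n + (n : ℝ)⁻¹ * ∑ a ∈ Ioc 1 k with a.Coprime n,
      (ArithmeticFunction.moebius a : ℝ) ^ 2 * e a + 3 * δ < 1) :
    n * δ - Real.log n < nonSquarefreeWeight n := by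
  have hn' : (0 : ℝ) < n := by exact_mod_cast hnp.pos
  have hs : ∀ p ∈ ({2, 3, 5} : Finset ℕ), p.Prime ∧ p ≤ k ∧ ¬ p ∣ n := by
    intro p hp
    simp only [mem_insert, mem_singleton] at hp
    have hpr : p.Prime := by rcases hp with rfl | rfl | rfl <;> norm_num
    refine ⟨hpr, by omega, fun hd => ?_⟩
    have := (Nat.prime_dvd_prime_iff_eq hpr hnp).1 hd
    omega
  have h1 := sum_primes_le_sum_moebius_sq (e := e) (n := n) (k := k)
    (fun a h1 h2 h3 => (abs_nonneg _).trans (he a h1 h2 h3)) _ hs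
  have h2 : ∀ p ∈ ({2, 3, 5} : Finset ℕ),
      (n : ℝ) * invPronic p - (nonSquarefreeWeight n + Real.log n) ≤ e p := by
    intro p hp
    obtain ⟨hpr, hpk, hd⟩ := hs p hp
    have := nonSquarefreeWeight_ge_of_error hnp.pos hpr
      (he p hpr.one_lt hpk ((hpr.coprime_iff_not_dvd).2 hd))
    rw [if_pos hnp] at this
    linarith
  have h3 := (sum_le_sum h2).trans h1
  have h4 : ∑ p ∈ ({2, 3, 5} : Finset ℕ),
      ((n : ℝ) * invPronic p - (nonSquarefreeWeight n + Real.log n))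
      = n * (43 / 60) - 3 * (nonSquarefreeWeight n + Real.log n) := by
    rw [sum_insert (by norm_num), sum_pair (by norm_num)]
    norm_num [invPronic]
    ring
  rw [h4] at h3
  have h5 := three_tenths_le_primeProd n
  set W := ∑ a ∈ Ioc 1 k with a.Coprime n, (ArithmeticFunction.moebius a : ℝ) ^ 2 * e a
  have h6 : (n : ℝ) * ((n : ℝ)⁻¹ * W) = W := mul_inv_cancel_left₀ hn'.ne' _
  -- The margin is `1/2 + 1/6 + 1/20 = 43/60 > 7/10 ≥ 1 - P(n)`.
  nlinarith

/-! ### The main theorem: prime and composite `n` -/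

theorem mainTheorem4 (A c : ℝ) (hA₀ : 0 < A) (hA : A < 1 / 2) (hc : 1 < c)
    (E : ℕ → ℕ → ℝ) (x : ℕ → ℝ)
    (hE : ∀ a : ℕ, 1 < a → (a : ℝ) ≤ c → ∀ n : ℕ, 0 < n → a.Coprime n → x a ≤ (n : ℝ) →
      |thetaAP n (a ^ 2) n - (n : ℝ) / (Nat.totient (a ^ 2) : ℝ)| ≤ E a n)
    (x₀ : ℝ) (hx₀ : ∀ a : ℕ, 1 < a → (a : ℝ) ≤ c → x a ≤ x₀)
    (n : ℕ) (hn₀ : 0 < n) (hn : x₀ ≤ (n : ℝ))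
    (hcond : 1 > primeProd n
      + (n : ℝ)⁻¹ * ∑ a ∈ Finset.Ioc 1 ⌊c⌋₊ with a.Coprime n,
          (ArithmeticFunction.moebius a : ℝ) ^ 2 * E a n
      + ((1 + 2 * A) / (1 - 2 * A)) * (4 / (c - 1))
      + 3 * Real.log n / (n : ℝ) ^ A) :
    (∑ a ∈ Finset.Ioc 1 (Nat.sqrt n),
        (ArithmeticFunction.moebius a : ℝ) * thetaAP n (a ^ 2) n < 0) ∧
      ∃ p s : ℕ, p.Prime ∧ 0 < s ∧ ¬ Squarefree s ∧ n = p + s := by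
  have he : ∀ a, 1 < a → a ≤ ⌊c⌋₊ → a.Coprime n →
      |thetaAP n (a ^ 2) n - (n : ℝ) / (Nat.totient (a ^ 2) : ℝ)| ≤ E a n := by
    intro a h1 h2 h3
    have hac : (a : ℝ) ≤ c := (Nat.le_floor_iff (by linarith)).1 h2
    exact hE a h1 hac n hn₀ h3 ((hx₀ a h1 hac).trans hn)
  have hn' : (1 : ℝ) ≤ n := by exact_mod_cast hn₀
  have hlog : 0 ≤ Real.log n := Real.log_natCast_nonneg n
  have hk : 1 ≤ ⌊c⌋₊ := (Nat.one_le_floor_iff c).2 hc.le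
  have hc' : 0 < c - 1 := by linarith
  have hratio : 4 / (c - 1) ≤ ((1 + 2 * A) / (1 - 2 * A)) * (4 / (c - 1)) := by
    refine le_mul_of_one_le_left (by positivity) ?_
    rw [one_le_div (by linarith)]
    linarith
  have hrpow : (n : ℝ) ^ A ≤ Real.sqrt n := by
    rw [Real.sqrt_eq_rpow]
    exact Real.rpow_le_rpow_of_exponent_le hn' hA.le
  have hlast : 3 * (Real.log n / Real.sqrt n) ≤ 3 * Real.log n / (n : ℝ) ^ A := by
    rw [← mul_div_assoc]
    exact div_le_div_of_nonneg_left (by positivity) (by positivity) hrpow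
  have hquot : 0 ≤ Real.log n / Real.sqrt n := by positivity
  have hfrac : 0 < 4 / (c - 1) := by positivity
  have hP := three_tenths_le_primeProd n
  have hsumE : 0 ≤ (n : ℝ)⁻¹ * ∑ a ∈ Ioc 1 ⌊c⌋₊ with a.Coprime n,
      (ArithmeticFunction.moebius a : ℝ) ^ 2 * E a n := by
    refine mul_nonneg (by positivity) ?_
    -- The empty set of primes gives nonnegativity of the error sum.
    simpa using sum_primes_le_sum_moebius_sq (e := fun a => E a n)
      (fun a h1 h2 h3 => (abs_nonneg _).trans (he a h1 h2 h3)) ∅ (by simp)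
  have hle := sum_moebius_mul_thetaAP_le hn₀
  suffices 0 < nonSquarefreeWeight n ∧
      (if n.Prime then (Real.sqrt n - 1) * Real.log n else 0) < nonSquarefreeWeight n from
    ⟨by linarith [this.2], exists_prime_add_not_squarefree_of_pos this.1⟩
  by_cases hnp : n.Prime
  · rw [if_pos hnp]
    have hc5 : 5 < c := by
      have : 4 / (c - 1) < 1 := by linarith
      rw [div_lt_one hc'] at this
      linarith
    have hsqrt : 0 < Real.sqrt n := by positivity
    -- Since `log n < √n / 3`, the bound `log n ≥ log 2` forces `n > 4`; then `log n ≥ log 4`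
    -- contradicts `√n ≤ 2.277`.
    have hn5 : 5 < n := by
      by_contra! hle5
      have h2 : Real.log 2 ≤ Real.log n :=
        Real.log_le_log two_pos (by exact_mod_cast hnp.two_le)
      have h3 : Real.log n / Real.sqrt n < 1 / 3 := by linarith
      rw [div_lt_iff₀ hsqrt] at h3
      have h5 : Real.sqrt n ≤ 2.07 * 1.1 := by
        rw [Real.sqrt_le_left (by norm_num)]
        have : (n : ℝ) ≤ 5 := by exact_mod_cast hle5
        norm_num
        linarith
      have hl2 := Real.log_two_gt_d9
      have h6 : 2.07 < Real.sqrt n := by linarith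
      have h7 : (2.07 : ℝ) ^ 2 < n := (Real.lt_sqrt (by norm_num)).1 h6
      have h8 : 4 < n := by
        by_contra! h
        have : (n : ℝ) ≤ 4 := by exact_mod_cast h
        norm_num at h7
        linarith
      have h9 : Real.log (2 ^ 2) ≤ Real.log n :=
        Real.log_le_log (by norm_num) (by
          have : (4 : ℝ) < n := by exact_mod_cast h8
          linarith)
      rw [Real.log_pow] at h9
      push_cast at h9
      linarith
    -- This `δ` makes `n δ - log n` exactly the excess `(√n - 1) log n`.
    have hmain := nonSquarefreeWeight_gt_of_prime hnp hn5
      (Nat.le_floor (by push_cast; linarith)) he (δ := Real.log n / Real.sqrt n)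
      (by linarith)
    have hid : (n : ℝ) * (Real.log n / Real.sqrt n) = Real.sqrt n * Real.log n := by
      rw [mul_div_left_comm, Real.div_sqrt, mul_comm]
    rw [hid] at hmain
    have h1 : 0 ≤ (Real.sqrt n - 1) * Real.log n :=
      mul_nonneg (sub_nonneg.2 (Real.one_le_sqrt.2 hn')) hlog
    constructor <;> linarith
  · rw [if_neg hnp, and_self_iff]
    refine nonSquarefreeWeight_pos_of_not_prime hn₀ hnp hk he ?_
    have hfl : c - 1 < ⌊c⌋₊ := Nat.sub_one_lt_floor c
    have h1 : (1 : ℝ) / ⌊c⌋₊ ≤ 4 / (c - 1) := by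
      refine (one_div_le_one_div_of_le hc' hfl.le).trans ?_
      gcongr
      norm_num
    linarith
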